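/- Work over $\mathbb{C}$. A plane Cremona map is a birational map $\mathbb{P}^2\dashrightarrow\mathbb{P}^2$, written $[f_0:f_1:f_2]$ with $f_0,f_1,f_2\in\mathbb{C}[x,y,z]$ homogeneous of the same degree; $\sigma=[yz:xz:xy]$ denotes the elementary quadratic transformation. A decomposition of a plane Cremona map $\varphi$ is an expression $$\varphi=\alpha_n\circ\sigma\circ\alpha_{n-1}\circ\sigma\circ\cdots\circ\alpha_1\circ\sigma\circ\alpha_0,\qquad \alpha_0,\dots,\alpha_n\in\operatorname{Aut}(\mathbb{P}^2)=\mathrm{PGL}_3(\mathbb{C}),\ n\ge 0;$$ it is minimal if $n$ is minimal among all decompositions of $\varphi$, and this minimal $n$ is the ordinary quadratic length $\mathrm{oq}(\varphi)$. Let $\tau=[x^2:xy:y^2-xz]$. Then $\mathrm{oq}(\tau)=4$, and the following is a minimal decomposition of $\tau$: $$\begin{aligned}\tau={}&[y-x:2y-x:x-y+z]\circ\sigma\circ[x+z:x:y]\circ\sigma\circ[-y:x-3y+z:x]\\&\circ\sigma\circ[x+z:x:y]\circ\sigma\circ[y-x:-2x+z:2x-y].\end{aligned}$$ -/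

import Mathlib

noncomputable section

namespace PlaneCremona

open MvPolynomial

/-- Triples `(f₀, f₁, f₂)` of polynomials in `ℂ[x, y, z]`; the variables are
`x = X 0`, `y = X 1`, `z = X 2`. -/
abbrev Triple : Type := Fin 3 → MvPolynomial (Fin 3) ℂ

/-- Substitution `F(G₀, G₁, G₂)`. -/
def comp (F G : Triple) : Triple := fun i => bind₁ G (F i)

/-- `F` defines a rational map `[f₀ : f₁ : f₂]` from the projective plane to itself: the `fᵢ` are
homogeneous of one and the same degree and not all zero. -/
def IsRational (F : Triple) : Prop := (∃ d : ℕ, ∀ i, (F i).IsHomogeneous d) ∧ F ≠ 0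

/-- `F` and `G` are proportional. Nonzero triples define the same rational map exactly if they are
proportional. -/
def Proportional (F G : Triple) : Prop := ∀ i j, F i * G j = F j * G i

/-- `F ∘ G` is defined as a rational map and is the identity map `[x : y : z]`. -/
def CompIsId (F G : Triple) : Prop := comp F G ≠ 0 ∧ Proportional (comp F G) X

/-- `F` defines a birational map of the projective plane. -/
def IsCremona (F : Triple) : Prop :=
  IsRational F ∧ ∃ G : Triple, IsRational G ∧ CompIsId F G ∧ CompIsId G F

theorem exists_ne_zero {F : Triple} (h : F ≠ 0) : ∃ i, F i ≠ 0 := by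
  by_contra! h'
  exact h (funext h')

theorem Proportional.trans {F G H : Triple} (hG : G ≠ 0) (h₁ : Proportional F G)
    (h₂ : Proportional G H) : Proportional F H := by
  obtain ⟨k, hk⟩ := exists_ne_zero hG
  intro i j
  apply mul_right_cancel₀ hk
  linear_combination H j * h₁ i k - H i * h₁ j k + F k * h₂ i j

theorem X_ne_zero' : (X : Triple) ≠ 0 := fun h => X_ne_zero (R := ℂ) (0 : Fin 3) (congrFun h 0)

theorem comp_assoc (F G H : Triple) : comp (comp F G) H = comp F (comp G H) := by
  funext i
  simp only [comp, bind₁_bind₁]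
  rfl

theorem comp_X (F : Triple) : comp F X = F := by
  funext i
  simp [comp, bind₁_X_left]

theorem X_comp (F : Triple) : comp X F = F := by
  funext i
  simp [comp]

theorem comp_homogeneous {F G : Triple} {d e : ℕ} (hF : ∀ i, (F i).IsHomogeneous d)
    (hG : ∀ i, (G i).IsHomogeneous e) (i : Fin 3) : (comp F G i).IsHomogeneous (e * d) :=
  (hF i).aeval G hG

theorem bind₁_smul {f : MvPolynomial (Fin 3) ℂ} {d : ℕ} (hf : f.IsHomogeneous d)
    (p : MvPolynomial (Fin 3) ℂ) (G : Triple) :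
    bind₁ (fun j => p * G j) f = p ^ d * bind₁ G f := by
  simp only [bind₁, aeval_def, eval₂_eq, Finset.mul_sum]
  refine Finset.sum_congr rfl fun m hm => ?_
  have hd : ∑ i, m i = d := by
    have h := hf (mem_support_iff.mp hm)
    rwa [Finsupp.weight_apply, Finsupp.sum_fintype _ _ (by simp), Finset.sum_congr rfl
      (fun i _ => by simp : ∀ i ∈ Finset.univ, m i • (1 : Fin 3 → ℕ) i = m i)] at h
  have hs : ∑ i ∈ m.support, m i = d := by
    rw [← hd]
    exact Finset.sum_subset (Finset.subset_univ _) (by simp)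
  simp only [mul_pow, Finset.prod_mul_distrib, Finset.prod_pow_eq_pow_sum, hs]
  ring

theorem key {f : MvPolynomial (Fin 3) ℂ} {d : ℕ} (hf : f.IsHomogeneous d) {G G' : Triple}
    (h : Proportional G G') (k : Fin 3) : G' k ^ d * bind₁ G f = G k ^ d * bind₁ G' f := by
  rw [← bind₁_smul hf, ← bind₁_smul hf]
  congr 2
  funext j
  rw [mul_comm, h j k]

theorem exists_both {G G' : Triple} (hG : G ≠ 0) (hG' : G' ≠ 0) (h : Proportional G G') :
    ∃ k, G k ≠ 0 ∧ G' k ≠ 0 := by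
  obtain ⟨k, hk⟩ := exists_ne_zero hG
  obtain ⟨l, hl⟩ := exists_ne_zero hG'
  refine ⟨k, hk, fun h0 => ?_⟩
  have := h k l
  rw [h0, mul_zero] at this
  exact mul_ne_zero hk hl this

theorem comp_ne_zero {F G : Triple} (hF : IsRational F) (hG : G ≠ 0) {G' : Triple} (hG' : G' ≠ 0)
    (h : Proportional G G') (hne : comp F G' ≠ 0) : comp F G ≠ 0 := by
  obtain ⟨⟨d, hd⟩, -⟩ := hF
  obtain ⟨k, hk, hk'⟩ := exists_both hG hG' h
  obtain ⟨i, hi⟩ := exists_ne_zero hne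
  intro h0
  have e := key (hd i) h k
  have e0 : bind₁ G (F i) = 0 := congrFun h0 i
  rw [e0, mul_zero] at e
  exact mul_ne_zero (pow_ne_zero _ hk) hi e.symm

theorem comp_proportional {F F' G G' : Triple} (hF : IsRational F)
    (hG : G ≠ 0) (hG' : G' ≠ 0) (h : Proportional F F') (h' : Proportional G G')
    (hne : comp F G' ≠ 0) :
    Proportional (comp F G) (comp F' G') := by
  have h1 : Proportional (comp F G) (comp F G') := by
    obtain ⟨⟨d, hd⟩, -⟩ := hF
    obtain ⟨k, hk, hk'⟩ := exists_both hG hG' h'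
    intro i j
    apply mul_left_cancel₀ (pow_ne_zero d hk')
    have ei := key (hd i) h' k
    have ej := key (hd j) h' k
    simp only [comp]
    linear_combination bind₁ G' (F j) * ei - bind₁ G' (F i) * ej
  refine h1.trans hne fun i j => ?_
  simp only [comp, ← map_mul, h i j]

/-- Composing with a birational triple on the right keeps a triple nonzero. -/
theorem comp_cremona_ne_zero {F G : Triple} (hF : IsRational F) (hG : IsCremona G) :
    comp F G ≠ 0 := by
  obtain ⟨-, H, -, ⟨hGH, hGH'⟩, -⟩ := hG
  have : comp F (comp G H) ≠ 0 :=
    comp_ne_zero hF hGH X_ne_zero' hGH' (by rw [comp_X]; exact hF.2)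
  intro h0
  rw [← comp_assoc, h0] at this
  exact this (funext fun i => by simp [comp])

theorem IsRational.comp {F G : Triple} (hF : IsRational F) (hG : IsCremona G) :
    IsRational (comp F G) := by
  refine ⟨?_, comp_cremona_ne_zero hF hG⟩
  obtain ⟨⟨d, hd⟩, -⟩ := hF
  obtain ⟨⟨⟨e, he⟩, -⟩, -⟩ := hG
  exact ⟨e * d, comp_homogeneous hd he⟩

theorem Proportional.refl (F : Triple) : Proportional F F := fun _ _ => mul_comm _ _

theorem compIsId_comp {F G F' G' : Triple} (hF : IsCremona F) (hG : IsCremona G)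
    (hF' : IsCremona F') (hG' : IsCremona G') (h₁ : CompIsId F F') (h₂ : CompIsId G G') :
    CompIsId (comp F G) (comp G' F') := by
  have e : comp (comp F G) (comp G' F') = comp F (comp (comp G G') F') := by
    simp only [comp_assoc]
  have hr : IsRational (comp G G') := hG.1.comp hG'
  have hne : comp (comp G G') F' ≠ 0 := comp_cremona_ne_zero hr hF'
  have hp : Proportional (comp (comp G G') F') F' := by
    have := comp_proportional hr hF'.1.2 hF'.1.2 h₂.2 (Proportional.refl F') hne
    rwa [X_comp] at this
  refine ⟨?_, ?_⟩
  · rw [e]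
    exact comp_ne_zero hF.1 hne hF'.1.2 hp h₁.1
  · rw [e]
    exact (comp_proportional hF.1 hne hF'.1.2 (Proportional.refl F) hp h₁.1).trans h₁.1 h₁.2

theorem IsCremona.comp {F G : Triple} (hF : IsCremona F) (hG : IsCremona G) :
    IsCremona (comp F G) := by
  obtain ⟨F', rF', hFF', hF'F⟩ := hF.2
  obtain ⟨G', rG', hGG', hG'G⟩ := hG.2
  have hF' : IsCremona F' := ⟨rF', F, hF.1, hF'F, hFF'⟩
  have hG' : IsCremona G' := ⟨rG', G, hG.1, hG'G, hGG'⟩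
  exact ⟨hF.1.comp hG, PlaneCremona.comp G' F', rG'.comp hF',
    compIsId_comp hF hG hF' hG' hFF' hGG', compIsId_comp hG' hF' hG hF hG'G hF'F⟩

/-- A practical criterion: `F ∘ G = p · (x, y, z)` and `G ∘ F = q · (x, y, z)`. -/
theorem isCremona_of_inverse {F G : Triple} {d e : ℕ} (hF : ∀ i, (F i).IsHomogeneous d)
    (hG : ∀ i, (G i).IsHomogeneous e) (p q : MvPolynomial (Fin 3) ℂ) (hp : p ≠ 0) (hq : q ≠ 0)
    (hFG : ∀ i, comp F G i = p * X i) (hGF : ∀ i, comp G F i = q * X i) : IsCremona F := by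
  have aux : ∀ (A B : Triple) (r : MvPolynomial (Fin 3) ℂ), r ≠ 0 →
      (∀ i, comp A B i = r * X i) → A ≠ 0 ∧ CompIsId A B := by
    intro A B r hr h
    have hne : comp A B ≠ 0 := fun h0 => by
      have := h 0
      rw [h0] at this
      exact mul_ne_zero hr (X_ne_zero (R := ℂ) (0 : Fin 3)) this.symm
    refine ⟨fun h0 => hne ?_, hne, fun i j => ?_⟩
    · funext i
      simp [comp, h0]
    · rw [h, h]
      ring
  exact ⟨⟨⟨d, hF⟩, (aux F G p hp hFG).1⟩, G, ⟨⟨e, hG⟩, (aux G F q hq hGF).1⟩,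
    (aux F G p hp hFG).2, (aux G F q hq hGF).2⟩

/-- Proportionality, as an equivalence relation on the triples that define birational maps. -/
instance cremonaSetoid : Setoid {F : Triple // IsCremona F} where
  r F G := Proportional F.1 G.1
  iseqv :=
    { refl := fun F => Proportional.refl F.1
      symm := fun {F G} h i j => by rw [mul_comm, h j i, mul_comm]
      trans := fun {_ G _} h₁ h₂ => h₁.trans G.2.1.2 h₂ }

end PlaneCremona

open PlaneCremona in
/-- The plane Cremona maps, that is the birational maps `ℙ² ⇢ ℙ²` over `ℂ`: triples
`[f₀ : f₁ : f₂]` of homogeneous polynomials of the same degree that define a birational map, up to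
proportionality. -/
def PlaneCremonaMap : Type := Quotient cremonaSetoid

namespace PlaneCremonaMap

open MvPolynomial PlaneCremona

/-- The plane Cremona map `[f₀ : f₁ : f₂]`. -/
def mk (F : Triple) (hF : IsCremona F) : PlaneCremonaMap := Quotient.mk cremonaSetoid ⟨F, hF⟩

/-- The product `φ * ψ` is the composition `φ ∘ ψ`, given by substitution. -/
instance : Mul PlaneCremonaMap where
  mul := Quotient.map₂ (fun F G => ⟨comp F.1 G.1, F.2.comp G.2⟩) fun F _ h G G' h' =>
    comp_proportional F.2.1 G.2.1.2 G'.2.1.2 h h' (comp_cremona_ne_zero F.2.1 G'.2)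

theorem mk_mul_mk (F G : Triple) (hF : IsCremona F) (hG : IsCremona G) :
    mk F hF * mk G hG = mk (comp F G) (hF.comp hG) := rfl

theorem mk_eq_mk {F G : Triple} {hF : IsCremona F} {hG : IsCremona G} :
    mk F hF = mk G hG ↔ Proportional F G := Quotient.eq (r := cremonaSetoid)

/-- The linear forms `A · (x, y, z)`. -/
def linearForms (A : Matrix (Fin 3) (Fin 3) ℂ) : Triple := fun i => ∑ j, C (A i j) * X j

theorem linearForms_homogeneous (A : Matrix (Fin 3) (Fin 3) ℂ) (i : Fin 3) :
    (linearForms A i).IsHomogeneous 1 :=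
  IsHomogeneous.sum _ _ _ fun j _ => isHomogeneous_C_mul_X _ j

theorem comp_linearForms (A B : Matrix (Fin 3) (Fin 3) ℂ) :
    comp (linearForms A) (linearForms B) = linearForms (A * B) := by
  funext i
  simp only [comp, linearForms, map_sum, map_mul, bind₁_C_right, bind₁_X_right, Matrix.mul_apply,
    Finset.mul_sum, Finset.sum_mul]
  rw [Finset.sum_comm]
  simp only [mul_assoc]

theorem linearForms_one : linearForms 1 = X := by
  funext i
  simp [linearForms, Matrix.one_apply]

theorem isCremona_linearForms (A : GL (Fin 3) ℂ) : IsCremona (linearForms A) :=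
  isCremona_of_inverse (G := linearForms (A⁻¹ : GL (Fin 3) ℂ)) (linearForms_homogeneous _)
    (linearForms_homogeneous _) 1 1 one_ne_zero one_ne_zero
    (fun i => by rw [comp_linearForms, ← Units.val_mul]; simp [linearForms_one])
    (fun i => by rw [comp_linearForms, ← Units.val_mul]; simp [linearForms_one])

/-- The automorphisms of the projective plane: the maps given by invertible `3 × 3` matrices. -/
def Aut : Set PlaneCremonaMap :=
  Set.range fun A : GL (Fin 3) ℂ => mk (linearForms A) (isCremona_linearForms A)

theorem homog_two_mul (i j : Fin 3) :
    (X i * X j : MvPolynomial (Fin 3) ℂ).IsHomogeneous 2 :=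
  (isHomogeneous_X ℂ i).mul (isHomogeneous_X ℂ j)

/-- The triple `(yz, xz, xy)`. -/
def sigmaForms : Triple := ![X 1 * X 2, X 0 * X 2, X 0 * X 1]

theorem isCremona_sigmaForms : IsCremona sigmaForms := by
  have hh : ∀ i, (sigmaForms i).IsHomogeneous 2 := by
    intro i
    fin_cases i <;> exact homog_two_mul _ _
  have hc : ∀ i, comp sigmaForms sigmaForms i = (X 0 * X 1 * X 2) * X i := by
    intro i
    fin_cases i <;> simp [comp, sigmaForms] <;> ring
  have h0 : (X 0 * X 1 * X 2 : MvPolynomial (Fin 3) ℂ) ≠ 0 :=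
    mul_ne_zero (mul_ne_zero (X_ne_zero _) (X_ne_zero _)) (X_ne_zero _)
  exact isCremona_of_inverse hh hh _ _ h0 h0 hc hc

/-- The elementary quadratic transformation `σ = [yz : xz : xy]`. -/
def sigma : PlaneCremonaMap := mk sigmaForms isCremona_sigmaForms

/-- The triple `(x², xy, y² - xz)`. -/
def tauForms : Triple := ![X 0 ^ 2, X 0 * X 1, X 1 ^ 2 - X 0 * X 2]

theorem isCremona_tauForms : IsCremona tauForms := by
  have hh : ∀ i, (tauForms i).IsHomogeneous 2 := by
    intro i
    fin_cases i
    · exact isHomogeneous_X_pow _ _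
    · exact homog_two_mul _ _
    · exact (isHomogeneous_X_pow _ _).sub (homog_two_mul _ _)
  have hc : ∀ i, comp tauForms tauForms i = X 0 ^ 3 * X i := by
    intro i
    fin_cases i <;> simp [comp, tauForms] <;> ring
  have h0 : (X 0 ^ 3 : MvPolynomial (Fin 3) ℂ) ≠ 0 := pow_ne_zero _ (X_ne_zero _)
  exact isCremona_of_inverse hh hh _ _ h0 h0 hc hc

/-- The quadratic map `τ = [x² : xy : y² - xz]`. -/
def tau : PlaneCremonaMap := mk tauForms isCremona_tauForms

/-- For `L = [αₙ, …, α₁]`, the map `αₙ ∘ σ ∘ αₙ₋₁ ∘ σ ∘ ⋯ ∘ α₁ ∘ σ ∘ α₀`. -/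
def sigmaWord (L : List PlaneCremonaMap) (α₀ : PlaneCremonaMap) : PlaneCremonaMap :=
  L.foldr (fun α ψ => α * (sigma * ψ)) α₀

/-- `φ = αₙ ∘ σ ∘ αₙ₋₁ ∘ σ ∘ ⋯ ∘ α₁ ∘ σ ∘ α₀` is a decomposition of `φ`, where `L = [αₙ, …, α₁]`
and all the `αᵢ` are automorphisms of the projective plane. The number of copies of `σ` is `n`,
the length of `L`. -/
def IsDecomposition (φ : PlaneCremonaMap) (L : List PlaneCremonaMap) (α₀ : PlaneCremonaMap) :
    Prop :=
  (∀ α ∈ L, α ∈ Aut) ∧ α₀ ∈ Aut ∧ φ = sigmaWord L α₀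

/-- A decomposition whose number of copies of `σ` is minimal among all decompositions. -/
def IsMinimalDecomposition (φ : PlaneCremonaMap) (L : List PlaneCremonaMap)
    (α₀ : PlaneCremonaMap) : Prop :=
  IsDecomposition φ L α₀ ∧
    ∀ (L' : List PlaneCremonaMap) (α₀' : PlaneCremonaMap), IsDecomposition φ L' α₀' →
      L.length ≤ L'.length

/-- The ordinary quadratic length: the minimal number of copies of `σ` in a decomposition
(`⊤` if there were no decomposition). -/
def oq (φ : PlaneCremonaMap) : ℕ∞ :=
  ⨅ (L : List PlaneCremonaMap) (α₀ : PlaneCremonaMap) (_ : IsDecomposition φ L α₀),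
    (L.length : ℕ∞)

/-- The triple of linear forms whose coefficients are the rows of `A` defines a birational map if
`det A ≠ 0`. -/
theorem isCremona_of_det {F : Triple} (A : Matrix (Fin 3) (Fin 3) ℂ) (hA : A.det ≠ 0)
    (h : F = linearForms A) : IsCremona F := by
  subst h
  exact isCremona_linearForms (Matrix.GeneralLinearGroup.mkOfDetNeZero A hA)

theorem C_two : (C 2 : MvPolynomial (Fin 3) ℂ) = 2 := map_ofNat C 2

theorem C_three : (C 3 : MvPolynomial (Fin 3) ℂ) = 3 := map_ofNat C 3

/-- `[y - x : 2y - x : x - y + z]` -/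
def tauAlpha₄ : PlaneCremonaMap :=
  mk ![X 1 - X 0, 2 * X 1 - X 0, X 0 - X 1 + X 2] <|
    isCremona_of_det !![-1, 1, 0; -1, 2, 0; 1, -1, 1] (by simp [Matrix.det_fin_three]; norm_num) <|
      by funext i; fin_cases i <;> simp [linearForms, Fin.sum_univ_three, C_two] <;> ring

/-- `[x + z : x : y]` -/
def tauAlpha₃ : PlaneCremonaMap :=
  mk ![X 0 + X 2, X 0, X 1] <|
    isCremona_of_det !![1, 0, 1; 1, 0, 0; 0, 1, 0] (by simp [Matrix.det_fin_three]) <|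
      by funext i; fin_cases i <;> simp [linearForms, Fin.sum_univ_three]

/-- `[-y : x - 3y + z : x]` -/
def tauAlpha₂ : PlaneCremonaMap :=
  mk ![-X 1, X 0 - 3 * X 1 + X 2, X 0] <|
    isCremona_of_det !![0, -1, 0; 1, -3, 1; 1, 0, 0] (by simp [Matrix.det_fin_three]) <|
      by funext i; fin_cases i <;> simp [linearForms, Fin.sum_univ_three, C_three] <;> ring

/-- `[x + z : x : y]` -/
def tauAlpha₁ : PlaneCremonaMap := tauAlpha₃

/-- `[y - x : -2x + z : 2x - y]` -/
def tauAlpha₀ : PlaneCremonaMap :=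
  mk ![X 1 - X 0, -2 * X 0 + X 2, 2 * X 0 - X 1] <|
    isCremona_of_det !![-1, 1, 0; -2, 0, 1; 2, -1, 0] (by simp [Matrix.det_fin_three]; norm_num) <|
      by funext i; fin_cases i <;> simp [linearForms, Fin.sum_univ_three, C_two] <;> ring

end PlaneCremonaMap

end

/-!
Words in `σ` of length less than three can be lengthened to length three: `σ ∘ σ` is the identity,
and `σ` is itself a word of length two (`exists_sigma_eq`). So it is enough to show that `τ` is not
a word of length exactly three, which means that `τ ∘ B ∘ σ = A ∘ σ ∘ D ∘ σ ∘ E` has no solution in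
automorphisms (`not_proportional_tau_sigmaNet`).

The left-hand side is the net of quartics spanned by `L₀²`, `L₀L₁`, `L₁² - L₀L₂`, where
`L₀, L₁, L₂` are conics spanning the conics through the three coordinate points; the right-hand side
is spanned by `M₁M₂`, `M₀M₂`, `M₀M₁`, where the conics `M` span the conics through the three base
points of `σ ∘ E`. The heart of the matter is that `L₀²` would belong to the second net. Since that
net vanishes at the base points of `σ ∘ E`, so does `L₀`; hence `L₀` is a linear form in
`M₀, M₁, M₂`, and its square would be a quadratic form in `M` without square terms, which is
impossible (`sigmaNet_ne_C_mul_sq`).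

If `L₀` and `L₁` are coprime, both nets have degree `4` and are equal, so `L₀²` belongs to the
second.
Otherwise `L₀` and `L₁` share a coordinate line `x`, and the second net is a line `n` times
the cubics `L₀² / x`, `L₀L₁ / x`, `(L₁² - L₀L₂) / x`. All members of the second net are singular at
the base points of `σ ∘ E`; comparing derivatives shows that `n` agrees at these three points with a
multiple of `x`, so `n` is a multiple of `x`, and once more `L₀²` belongs to the second net.
-/

/-! ### The monoid of plane Cremona maps and decompositions -/

namespace PlaneCremonaMap

open MvPolynomial PlaneCremona

/-- Plane Cremona maps form a monoid under composition. -/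
noncomputable instance : Monoid PlaneCremonaMap where
  mul_assoc φ ψ χ := by
    induction φ using Quotient.ind with | _ F
    induction ψ using Quotient.ind with | _ G
    induction χ using Quotient.ind with | _ H
    exact congrArg _ (Subtype.ext (comp_assoc F.1 G.1 H.1))
  one := mk X (linearForms_one ▸ isCremona_linearForms 1)
  one_mul φ := by
    induction φ using Quotient.ind with | _ F
    exact congrArg _ (Subtype.ext (X_comp F.1))
  mul_one φ := by
    induction φ using Quotient.ind with | _ F
    exact congrArg _ (Subtype.ext (comp_X F.1))

/-- The automorphism of the plane given by an invertible matrix, as a monoid homomorphism. -/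
noncomputable def linear : GL (Fin 3) ℂ →* PlaneCremonaMap where
  toFun A := mk (linearForms A) (isCremona_linearForms A)
  map_one' := congrArg _ (Subtype.ext linearForms_one)
  map_mul' A B := congrArg _ (Subtype.ext (comp_linearForms A.1 B.1).symm)

theorem mem_aut_iff {α : PlaneCremonaMap} : α ∈ Aut ↔ ∃ A, linear A = α := Iff.rfl

theorem one_mem_aut : (1 : PlaneCremonaMap) ∈ Aut := ⟨1, map_one linear⟩

theorem mul_mem_aut {α β : PlaneCremonaMap} (hα : α ∈ Aut) (hβ : β ∈ Aut) : α * β ∈ Aut := by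
  obtain ⟨A, rfl⟩ := mem_aut_iff.1 hα
  obtain ⟨B, rfl⟩ := mem_aut_iff.1 hβ
  exact ⟨A * B, map_mul linear A B⟩

theorem mk_mem_aut_of_det {F : Triple} (A : Matrix (Fin 3) (Fin 3) ℂ) (hA : A.det ≠ 0)
    (h : F = linearForms A) : mk F (isCremona_of_det A hA h) ∈ Aut := by
  subst h
  exact ⟨Matrix.GeneralLinearGroup.mkOfDetNeZero A hA, rfl⟩

theorem sigma_mul_sigma : sigma * sigma = 1 := by
  refine mk_eq_mk.2 fun i j => ?_
  fin_cases i <;> fin_cases j <;> simp [comp, sigmaForms] <;> ring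

theorem sigma_mul_sigma_mul (φ : PlaneCremonaMap) : sigma * (sigma * φ) = φ := by
  rw [← mul_assoc, sigma_mul_sigma, one_mul]

/-- The standard quadratic map is a word of length two in itself: in affine coordinates it is, up to
automorphisms, the composition of `(x, y) ↦ (x, x / y)`, the translation by `(1, 1)`, and
`(x, y) ↦ (x, x / y)` again. -/
theorem exists_sigma_eq : ∃ α ∈ Aut, ∃ β ∈ Aut, ∃ γ ∈ Aut,
    sigma = α * (sigma * (β * (sigma * γ))) := by
  refine ⟨_, mk_mem_aut_of_det (F := ![X 2, X 2 - X 0, X 2 - X 1])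
      !![0, 0, 1; -1, 0, 1; 0, -1, 1] (by simp [Matrix.det_fin_three]) ?_,
    _, mk_mem_aut_of_det (F := ![X 0 + X 2, X 0 + X 1, X 0])
      !![1, 0, 1; 1, 1, 0; 1, 0, 0] (by simp [Matrix.det_fin_three]) ?_,
    _, mk_mem_aut_of_det (F := ![X 0, X 2 - X 0, X 1 - X 0])
      !![1, 0, 0; -1, 0, 1; -1, 1, 0] (by simp [Matrix.det_fin_three]) ?_, ?_⟩
  · funext i; fin_cases i <;> simp [linearForms, Fin.sum_univ_three] <;> ring
  · funext i; fin_cases i <;> simp [linearForms, Fin.sum_univ_three]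
  · funext i; fin_cases i <;> simp [linearForms, Fin.sum_univ_three] <;> ring
  · refine mk_eq_mk.2 fun i j => ?_
    fin_cases i <;> fin_cases j <;> simp [comp, sigmaForms] <;> ring

/-- A map with a decomposition of length at most `3` has one of length exactly `3`. -/
theorem IsDecomposition.exists_length_three {φ : PlaneCremonaMap} {L : List PlaneCremonaMap}
    {α₀ : PlaneCremonaMap} (h : IsDecomposition φ L α₀) (hL : L.length < 4) :
    ∃ α₃ ∈ Aut, ∃ α₂ ∈ Aut, ∃ α₁ ∈ Aut, ∃ α₀ ∈ Aut,
      φ = α₃ * (sigma * (α₂ * (sigma * (α₁ * (sigma * α₀))))) := by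
  obtain ⟨hL', h₀, rfl⟩ := h
  obtain ⟨a, ha, b, hb, c, hc, e⟩ := exists_sigma_eq
  match L, hL with
  | [], _ =>
    refine ⟨1, one_mem_aut, a, ha, b, hb, c * α₀, mul_mem_aut hc h₀, ?_⟩
    have e' : a * (sigma * (b * (sigma * (c * α₀)))) = sigma * α₀ := by
      conv_rhs => rw [e]
      simp only [mul_assoc]
    rw [e', sigma_mul_sigma_mul, one_mul]
    rfl
  | [α₁], _ =>
    refine ⟨α₁, hL' _ (by simp), 1, one_mem_aut, 1, one_mem_aut, α₀, h₀, ?_⟩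
    simp only [one_mul, sigma_mul_sigma_mul, sigmaWord, List.foldr]
  | [α₂, α₁], _ =>
    refine ⟨α₂, hL' _ (by simp), α₁ * a, mul_mem_aut (hL' _ (by simp)) ha, b, hb, c * α₀,
      mul_mem_aut hc h₀, ?_⟩
    simp only [sigmaWord, List.foldr]
    conv_lhs => rw [show sigma * α₀ = a * (sigma * (b * (sigma * (c * α₀)))) by
      conv_lhs => rw [e]
      simp only [mul_assoc]]
    simp only [mul_assoc]
  | [α₃, α₂, α₁], _ =>
    exact ⟨α₃, hL' _ (by simp), α₂, hL' _ (by simp), α₁, hL' _ (by simp), α₀, h₀, rfl⟩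

theorem isDecomposition_tau :
    IsDecomposition tau [tauAlpha₄, tauAlpha₃, tauAlpha₂, tauAlpha₁] tauAlpha₀ := by
  have h₀ : tauAlpha₀ ∈ Aut := by
    refine mk_mem_aut_of_det !![-1, 1, 0; -2, 0, 1; 2, -1, 0] ?_ ?_
    · simp [Matrix.det_fin_three]; norm_num
    · funext i; fin_cases i <;> simp [linearForms, Fin.sum_univ_three, C_two] <;> ring
  have h₂ : tauAlpha₂ ∈ Aut := by
    refine mk_mem_aut_of_det !![0, -1, 0; 1, -3, 1; 1, 0, 0] ?_ ?_
    · simp [Matrix.det_fin_three]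
    · funext i; fin_cases i <;> simp [linearForms, Fin.sum_univ_three, C_three]
      ring
  have h₃ : tauAlpha₃ ∈ Aut := by
    refine mk_mem_aut_of_det !![1, 0, 1; 1, 0, 0; 0, 1, 0] ?_ ?_
    · simp [Matrix.det_fin_three]
    · funext i; fin_cases i <;> simp [linearForms, Fin.sum_univ_three]
  have h₄ : tauAlpha₄ ∈ Aut := by
    refine mk_mem_aut_of_det !![-1, 1, 0; -1, 2, 0; 1, -1, 1] ?_ ?_
    · simp [Matrix.det_fin_three]; norm_num
    · funext i; fin_cases i <;> simp [linearForms, Fin.sum_univ_three, C_two] <;> ring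
  refine ⟨?_, h₀, ?_⟩
  · simp only [List.mem_cons, List.not_mem_nil, or_false, forall_eq_or_imp, forall_eq]
    exact ⟨h₄, h₃, h₂, h₃⟩
  · -- Moving `α₄ ∘ σ ∘ α₃ ∘ σ` to the other side keeps the degrees of the two triples to be
    -- compared small; `β₃` and `β₄` are the inverses of `α₃` and `α₄`.
    let β₃ : PlaneCremonaMap := mk ![X 1, X 2, X 0 - X 1] <|
      isCremona_of_det !![0, 1, 0; 0, 0, 1; 1, -1, 0] (by simp [Matrix.det_fin_three]) <| by
        funext i; fin_cases i <;> simp [linearForms, Fin.sum_univ_three]; ring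
    let β₄ : PlaneCremonaMap := mk ![X 1 - 2 * X 0, X 1 - X 0, X 0 + X 2] <|
      isCremona_of_det !![-2, 1, 0; -1, 1, 0; 1, 0, 1] (by simp [Matrix.det_fin_three]; norm_num) <|
        by funext i; fin_cases i <;> simp [linearForms, Fin.sum_univ_three, C_two] <;> ring
    have e₃ (φ : PlaneCremonaMap) : tauAlpha₃ * (β₃ * φ) = φ := by
      rw [← mul_assoc]
      convert one_mul φ
      refine mk_eq_mk.2 fun i j => ?_
      fin_cases i <;> fin_cases j <;> simp [comp] <;> ring
    have e₄ (φ : PlaneCremonaMap) : tauAlpha₄ * (β₄ * φ) = φ := by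
      rw [← mul_assoc]
      convert one_mul φ
      refine mk_eq_mk.2 fun i j => ?_
      fin_cases i <;> fin_cases j <;> simp [comp, map_ofNat] <;> ring
    have h : sigma * (β₃ * (sigma * (β₄ * tau)))
        = tauAlpha₂ * (sigma * (tauAlpha₁ * (sigma * tauAlpha₀))) := by
      refine mk_eq_mk.2 fun i j => ?_
      fin_cases i <;> fin_cases j <;> simp [comp, sigmaForms, tauForms, map_ofNat] <;> ring
    simp only [sigmaWord, List.foldr]
    rw [← h, sigma_mul_sigma_mul, e₃, sigma_mul_sigma_mul, e₄]

end PlaneCremonaMap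

/-! ### Divisibility and homogeneity -/

/-- Under these coprimality conditions, a triple proportional to `(e p², e p q, e q² - r p)` is a
multiple of it. The two equations `E₁` and `E₂` are the proportionality of the triples, cleared of
the factors `e p` and `p`. -/
theorem eq_mul_of_isRelPrime {R : Type*} [CommRing R] [IsDomain R] [UniqueFactorizationMonoid R]
    {p q e r h₀ h₁ h₂ : R} (hp : p ≠ 0) (he : e ≠ 0) (hpq : IsRelPrime p q)
    (hpe : IsRelPrime p e) (her : IsRelPrime e r) (E₁ : p * h₁ = q * h₀)
    (E₂ : e * p * h₂ + r * h₀ = e * q * h₁) :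
    ∃ c, h₀ = c * (e * p ^ 2) ∧ h₁ = c * (e * (p * q)) ∧ h₂ = c * (e * q ^ 2 - r * p) := by
  obtain ⟨k, rfl⟩ : p ∣ h₀ := hpq.dvd_of_dvd_mul_left ⟨h₁, E₁.symm⟩
  obtain rfl : h₁ = q * k := mul_left_cancel₀ hp (by linear_combination E₁)
  obtain ⟨j, rfl⟩ : p ∣ k := by
    refine hpq.dvd_of_dvd_mul_left (hpq.dvd_of_dvd_mul_left (hpe.dvd_of_dvd_mul_left
      ⟨e * h₂ + r * k, ?_⟩))
    linear_combination -E₂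
  have E₃ : e * h₂ + r * (p * j) = e * (q * (q * j)) :=
    mul_left_cancel₀ hp (by linear_combination E₂)
  obtain ⟨c, rfl⟩ : e ∣ j := by
    refine hpe.symm.dvd_of_dvd_mul_left (her.dvd_of_dvd_mul_left ⟨q * (q * j) - h₂, ?_⟩)
    linear_combination E₃
  refine ⟨c, by ring, by ring, mul_left_cancel₀ he (by linear_combination E₃)⟩

namespace MvPolynomial

variable {n : Type*} {K : Type*} [Field K]

theorem irreducible_binomial {i j : n} (hij : i ≠ j) {a b : K} (ha : a ≠ 0) :
    Irreducible (C a * X i + C b * X j : MvPolynomial n K) := by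
  classical
  refine irreducible_mul_X_add _ _ i (by simpa using ha) (by simp) (fun h => hij ?_) ?_
  · simpa using (vars_mul _ _ h)
  · exact IsUnit.isRelPrime_left (ha.isUnit.map C)

theorem isRelPrime_X_X {i j : n} (hij : i ≠ j) :
    IsRelPrime (X i : MvPolynomial n K) (X j) := by
  refine (X_prime (i := i)).irreducible.isRelPrime_iff_not_dvd.2 fun ⟨u, hu⟩ => ?_
  classical
  simpa [hij.symm] using congrArg (eval (Pi.single j (1 : K))) hu

theorem isRelPrime_X_of_eval {i : n} {f : MvPolynomial n K} {P : n → K} (hP : P i = 0)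
    (hf : eval P f ≠ 0) : IsRelPrime (X i) f := by
  refine (X_prime (i := i)).irreducible.isRelPrime_iff_not_dvd.2 fun ⟨u, hu⟩ => hf ?_
  simp [hu, hP]

theorem IsHomogeneous.eq_homogeneousComponent_mul {R : Type*} [CommSemiring R] {d e : ℕ}
    {f g c : MvPolynomial n R} (hg : g.IsHomogeneous e)
    (hf : f.IsHomogeneous (d + e)) (h : f = c * g) : f = homogeneousComponent d c * g := by
  let _ := gradedAlgebra (σ := n) (R := R)
  classical
  have := DirectSum.coe_decompose_mul_add_of_right_mem (homogeneousSubmodule n R) (i := d) (a := c)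
    (b := g) (j := e) hg
  rw [← h, DirectSum.decompose_of_mem_same (homogeneousSubmodule n R) hf] at this
  rw [this]
  congr 1
  exact decomposition.decompose'_apply c d

theorem IsHomogeneous.eq_sum_C_mul_X {R : Type*} [CommSemiring R] [Fintype n]
    {f : MvPolynomial n R} (hf : f.IsHomogeneous 1) :
    ∃ a : n → R, f = ∑ i, C (a i) * X i := by
  have h : f ∈ homogeneousSubmodule n R 1 := hf
  rw [homogeneousSubmodule_one_eq_span_X, Submodule.mem_span_range_iff_exists_fun] at h
  obtain ⟨a, ha⟩ := h
  exact ⟨a, by simp [← ha, smul_eq_C_mul]⟩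

end MvPolynomial

/-! ### Conics through the coordinate points -/

namespace PlaneCremonaMap

open MvPolynomial PlaneCremona

/-- The conic `b₀ yz + b₁ xz + b₂ xy` through the three coordinate points. -/
noncomputable def conic (b : Fin 3 → ℂ) : MvPolynomial (Fin 3) ℂ :=
  ∑ j, C (b j) * (X (j + 1) * X (j + 2))

theorem sigmaForms_apply (i : Fin 3) : sigmaForms i = X (i + 1) * X (i + 2) := by
  fin_cases i
  · rfl
  · exact mul_comm _ _
  · rfl

theorem comp_linearForms_apply (A : Matrix (Fin 3) (Fin 3) ℂ) (G : Triple) (i : Fin 3) :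
    comp (linearForms A) G i = ∑ j, C (A i j) * G j := by
  simp [comp, linearForms]

theorem comp_sigmaForms_apply (G : Triple) (i : Fin 3) :
    comp sigmaForms G i = G (i + 1) * G (i + 2) := by
  simp [comp, sigmaForms_apply]

theorem comp_linearForms_sigmaForms (B : Matrix (Fin 3) (Fin 3) ℂ) (i : Fin 3) :
    comp (linearForms B) sigmaForms i = conic (B i) := by
  simp [comp_linearForms_apply, sigmaForms_apply, conic]

theorem sum_eq_cyclic {M : Type*} [AddCommMonoid M] (f : Fin 3 → M) (i : Fin 3) :
    ∑ j, f j = f i + f (i + 1) + f (i + 2) := by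
  fin_cases i
  · exact Fin.sum_univ_three f
  · simp only [Fin.sum_univ_three]; exact (add_rotate _ _ _)
  · simp only [Fin.sum_univ_three]; exact (add_rotate _ _ _).trans (add_rotate _ _ _)

-- Arithmetic of the cyclic indices `i`, `i + 1`, `i + 2` in `Fin 3`.

theorem add_two_add_one (i : Fin 3) : i + 2 + 1 = i := by fin_cases i <;> rfl
theorem add_two_add_two (i : Fin 3) : i + 2 + 2 = i + 1 := by fin_cases i <;> rfl
theorem add_one_add_one (i : Fin 3) : i + 1 + 1 = i + 2 := by fin_cases i <;> rfl
theorem add_one_add_two (i : Fin 3) : i + 1 + 2 = i := by fin_cases i <;> rfl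
theorem add_one_ne (i : Fin 3) : i + 1 ≠ i := by fin_cases i <;> decide
theorem add_two_ne (i : Fin 3) : i + 2 ≠ i := by fin_cases i <;> decide
theorem add_one_ne_add_two (i : Fin 3) : i + 1 ≠ i + 2 := by fin_cases i <;> decide
theorem eq_or_eq_add_one_or_eq_add_two :
    ∀ i k : Fin 3, k = i ∨ k = i + 1 ∨ k = i + 2 := by decide

theorem conic_eq (b : Fin 3 → ℂ) (i : Fin 3) :
    conic b = C (b i) * (X (i + 1) * X (i + 2)) + C (b (i + 1)) * (X (i + 2) * X i) +
      C (b (i + 2)) * (X i * X (i + 1)) := by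
  rw [conic, sum_eq_cyclic _ i, add_one_add_one, add_one_add_two, add_two_add_one, add_two_add_two]

theorem conic_homogeneous (b : Fin 3 → ℂ) : (conic b).IsHomogeneous 2 :=
  IsHomogeneous.sum _ _ _ fun _ _ => (homog_two_mul _ _).C_mul _

/-- The point with coordinate `0` at `i` and `1` elsewhere, where a conic through the coordinate
points takes its `i`-th coefficient as value. -/
theorem eval_conic_indicator (b : Fin 3 → ℂ) (i : Fin 3) :
    eval (fun k => if k = i then 0 else 1) (conic b) = b i := by
  simp [conic_eq b i]

theorem conic_ne_zero {b : Fin 3 → ℂ} (hb : b ≠ 0) : conic b ≠ 0 := fun h =>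
  hb (funext fun i => by rw [← eval_conic_indicator b i, h]; simp)

theorem eval_linearForms (A : Matrix (Fin 3) (Fin 3) ℂ) (P : Fin 3 → ℂ) (i : Fin 3) :
    eval P (linearForms A i) = (A.mulVec P) i := by
  simp [linearForms, Matrix.mulVec, dotProduct]

theorem eval_comp (F G : Triple) (P : Fin 3 → ℂ) (i : Fin 3) :
    eval P (comp F G i) = eval (fun j => eval P (G j)) (F i) := by
  simp only [comp, ← coe_aeval_eq_eval, RingHom.coe_coe, aeval_bind₁]

theorem eval_conic (b P : Fin 3 → ℂ) :
    eval P (conic b) = ∑ j, b j * (P (j + 1) * P (j + 2)) := by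
  simp [conic]

/-- A conic through three points spanning the plane is a combination of products of two of the
three coordinates with respect to these points. -/
theorem exists_eval_conic_mulVec (b : Fin 3 → ℂ) (T : Matrix (Fin 3) (Fin 3) ℂ)
    (h : ∀ j, eval (T.col j) (conic b) = 0) :
    ∃ s : Fin 3 → ℂ, ∀ v : Fin 3 → ℂ,
      eval (T.mulVec v) (conic b) = ∑ j, s j * (v (j + 1) * v (j + 2)) := by
  refine ⟨fun j => eval (T.col (j + 1) + T.col (j + 2)) (conic b), fun v => ?_⟩
  have h0 := h 0
  have h1 := h 1
  have h2 := h 2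
  simp [eval_conic, Fin.sum_univ_three, Matrix.mulVec, dotProduct] at h0 h1 h2 ⊢
  linear_combination (v 0 ^ 2 - v 0 * v 1 - v 0 * v 2) * h0 + (v 1 ^ 2 - v 0 * v 1 - v 1 * v 2) * h1
    + (v 2 ^ 2 - v 0 * v 2 - v 1 * v 2) * h2

/-- A nonzero quadratic form without square terms is not a multiple of the square of a linear
form. -/
theorem eq_zero_of_sum_mul_eq_sq {a t : Fin 3 → ℂ} {c : ℂ}
    (h : ∀ u : Fin 3 → ℂ, ∑ k, a k * (u (k + 1) * u (k + 2)) = c * (∑ k, t k * u k) ^ 2) :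
    a = 0 := by
  have hs (k : Fin 3) : c * t k ^ 2 = 0 := by
    have := h (Pi.single k 1)
    rw [sum_eq_cyclic _ k, sum_eq_cyclic _ k] at this
    simpa [add_one_ne, add_two_ne, add_one_add_one, add_two_add_one, add_one_add_two,
      add_two_add_two] using this.symm
  have hm (k l : Fin 3) : c * (t k * t l) = 0 := by
    rcases mul_eq_zero.1 (hs k) with h | h
    · simp [h]
    · simp [pow_eq_zero_iff two_ne_zero |>.1 h]
  funext k
  have := h (fun j => if j = k then 0 else 1)
  rw [sum_eq_cyclic _ k, sum_eq_cyclic _ k] at this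
  simp [add_two_add_one, add_one_add_two] at this
  rw [this, Pi.zero_apply]
  linear_combination hs (k + 1) + hs (k + 2) + 2 * hm (k + 1) (k + 2)

theorem det_ne_zero (B : GL (Fin 3) ℂ) : B.1.det ≠ 0 := (B.isUnit.map Matrix.detMonoidHom).ne_zero

theorem row_ne_zero (A : GL (Fin 3) ℂ) (i : Fin 3) : A.1 i ≠ 0 := fun h =>
  det_ne_zero A <| Matrix.det_eq_zero_of_row_eq_zero i fun j => congrFun h j

theorem col_ne_zero (A : GL (Fin 3) ℂ) (j : Fin 3) : A.1.col j ≠ 0 := fun h =>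
  det_ne_zero A <| Matrix.det_eq_zero_of_column_eq_zero j fun i => congrFun h i

/-- Two conics through the coordinate points are coprime if they are independent and have no common
coordinate line. Eliminating the coefficient at `i` from `conic b` and `conic b'` leaves the
coordinate line `X i` and a further line, with coefficients from the cross product `w` of `b` and
`b'`; a common irreducible factor divides all three of these lines. -/
theorem isRelPrime_conic {b b' : Fin 3 → ℂ} (hcol : ∀ i, ¬ (b i = 0 ∧ b' i = 0))
    (hw : ∃ i, b (i + 1) * b' (i + 2) - b (i + 2) * b' (i + 1) ≠ 0) :
    IsRelPrime (conic b) (conic b') := by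
  set w : Fin 3 → ℂ := fun i => b (i + 1) * b' (i + 2) - b (i + 2) * b' (i + 1) with hwdef
  refine WfDvdMonoid.isRelPrime_of_no_irreducible_factors (fun h => hcol 0 ?_)
    fun g hg hgb hgb' => ?_
  · rw [← eval_conic_indicator b 0, ← eval_conic_indicator b' 0, h.1, h.2]
    simp
  have hgX (i : Fin 3) : ¬ g ∣ X i := fun hgi => by
    have hXg : X i ∣ g := (hg.dvd_symm X_prime.irreducible hgi)
    obtain ⟨u, hu⟩ := hXg.trans hgb
    obtain ⟨u', hu'⟩ := hXg.trans hgb'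
    refine hcol i ?_
    rw [← eval_conic_indicator b i, ← eval_conic_indicator b' i, hu, hu']
    simp
  have hgw (i : Fin 3) : g ∣ C (w (i + 1)) * X (i + 1) + C (-w (i + 2)) * X (i + 2) := by
    refine (hg.prime.dvd_or_dvd ?_).resolve_left (hgX i)
    have := (hgb.mul_left (C (b' i))).sub (hgb'.mul_left (C (b i)))
    convert this using 1
    simp only [conic_eq b i, conic_eq b' i, hwdef, add_one_add_one, add_one_add_two,
      add_two_add_one, add_two_add_two, map_sub, map_mul, map_neg]
    ring
  have hgC {c : ℂ} {i : Fin 3} (h : g ∣ C c * X i) : c = 0 := by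
    by_contra hc
    exact (hg.prime.dvd_or_dvd h).elim
      (fun h => hg.not_isUnit (isUnit_of_dvd_unit h (Ne.isUnit hc |>.map C))) (hgX i)
  have hw0 (i : Fin 3) : w i ≠ 0 := fun h0 => by
    have h1 := hgw (i + 1)
    have h2 := hgw (i + 2)
    simp only [add_one_add_one, add_one_add_two, add_two_add_one, add_two_add_two, h0, neg_zero,
      C_0, zero_mul, add_zero, zero_add] at h1 h2
    have h1 := hgC h1
    have h2 := neg_eq_zero.1 (hgC h2)
    obtain ⟨k, hk⟩ := hw
    refine hk ?_
    change w k = 0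
    rcases eq_or_eq_add_one_or_eq_add_two i k with rfl | rfl | rfl <;> assumption
  obtain ⟨u, hu⟩ := (hg.dvd_symm (irreducible_binomial (by decide) (hw0 _)) (hgw 0)).trans (hgw 1)
  have := congrArg (eval ![0, w 2, w 1]) hu
  simp [mul_comm (w 1), hw0] at this

end PlaneCremonaMap

/-! ### Triples of the maps `A ∘ σ ∘ D ∘ σ ∘ E` -/

namespace PlaneCremonaMap

open MvPolynomial PlaneCremona

/-- The triple `A ∘ σ ∘ D ∘ σ ∘ E` of quartics, without cancellation of common factors. The columns
of `E⁻¹` are the base points of `σ ∘ E`. -/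
noncomputable def sigmaNet (A D E : Matrix (Fin 3) (Fin 3) ℂ) : Triple :=
  comp (linearForms A) (comp sigmaForms (comp (comp (linearForms D) sigmaForms) (linearForms E)))

theorem sigmaNet_apply (A D E : Matrix (Fin 3) (Fin 3) ℂ) (l : Fin 3) :
    sigmaNet A D E l = ∑ k, C (A l k) *
      (comp (comp (linearForms D) sigmaForms) (linearForms E) (k + 1) *
        comp (comp (linearForms D) sigmaForms) (linearForms E) (k + 2)) := by
  simp only [sigmaNet, comp_linearForms_apply A, comp_sigmaForms_apply]

theorem eval_comp_conics (D E : GL (Fin 3) ℂ) (v : Fin 3 → ℂ) (i : Fin 3) :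
    eval ((E⁻¹).1.mulVec v) (comp (comp (linearForms D) sigmaForms) (linearForms E) i) =
      ∑ k, D.1 i k * (v (k + 1) * v (k + 2)) := by
  have : (fun j => eval ((E⁻¹).1.mulVec v) (linearForms E.1 j)) = v := by
    funext j
    rw [eval_linearForms, Matrix.mulVec_mulVec, ← Units.val_mul]
    simp
  rw [eval_comp, this, comp_linearForms_sigmaForms, eval_conic]

/-- If a conic `L` passes through the coordinate points and through the base points of `σ ∘ E`, then
`L` is a linear form in the three conics `M = D ∘ σ ∘ E`. As these are algebraically independent and
every component of `A ∘ σ ∘ D ∘ σ ∘ E` is a nonzero quadratic form in `M` without square terms, no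
component is a scalar multiple of `L²`. The scalar `c = 0` is included: no component vanishes. -/
theorem sigmaNet_ne_C_mul_sq (A D E : GL (Fin 3) ℂ) (b : Fin 3 → ℂ) (c : ℂ) (i : Fin 3)
    (hb : ∀ j, eval ((E⁻¹).1.col j) (conic b) = 0)
    (h : sigmaNet A D E i = C c * conic b ^ 2) : False := by
  obtain ⟨s, hs⟩ := exists_eval_conic_mulVec b _ hb
  -- `f` expresses the difference of the two sides as a quadratic form in the coordinates of a
  -- second plane, through the birational map `w ↦ E⁻¹ (σ w)`.
  let f : MvPolynomial (Fin 3) ℂ :=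
    ∑ k, C (A.1 i k) * (linearForms D (k + 1) * linearForms D (k + 2)) -
      C c * (∑ k, C (s k) * X k) ^ 2
  have hf : (X 0 * X 1 * X 2) ^ 2 * f = 0 := by
    refine MvPolynomial.funext fun w => ?_
    have e := congrArg (eval ((E⁻¹).1.mulVec fun k => w (k + 1) * w (k + 2))) h
    have hk (k : Fin 3) : w (k + 1 + 1) * w (k + 1 + 2) * (w (k + 2 + 1) * w (k + 2 + 2)) =
        w 0 * w 1 * w 2 * w k := by
      fin_cases k <;> simp <;> ring
    simp only [sigmaNet_apply, map_sum, map_mul, map_pow, eval_C,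
      eval_comp_conics, hs, hk] at e
    simp only [f, map_mul, map_pow, map_sub, map_sum, eval_X, eval_C, eval_linearForms,
      Matrix.mulVec, dotProduct, map_zero]
    simp only [Fin.sum_univ_three] at e ⊢
    linear_combination e
  have hX (k : Fin 3) : (X k : MvPolynomial (Fin 3) ℂ) ≠ 0 := X_ne_zero k
  have hf0 : f = 0 := by simpa [hX] using hf
  refine row_ne_zero A i (eq_zero_of_sum_mul_eq_sq (c := c) (t := Matrix.vecMul s (D⁻¹).1)
    fun u => ?_)
  have e := congrArg (eval ((D⁻¹).1.mulVec u)) hf0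
  simp only [f, map_mul, map_pow, map_sub, map_sum, eval_X, eval_C, eval_linearForms, map_zero,
    Matrix.mulVec_mulVec, ← Units.val_mul, mul_inv_cancel, Units.val_one, Matrix.one_mulVec] at e
  have hd := Matrix.dotProduct_mulVec s (D⁻¹).1 u
  simp only [dotProduct] at hd
  rw [← hd]
  linear_combination e

theorem sigmaNet_homogeneous (A D E : GL (Fin 3) ℂ) (l : Fin 3) :
    (sigmaNet A D E l).IsHomogeneous 4 := by
  have h2 (i) : (comp (comp (linearForms D) sigmaForms) (linearForms E) i).IsHomogeneous 2 := by
    refine comp_homogeneous (d := 2) (e := 1) (fun i => ?_) (linearForms_homogeneous _) i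
    rw [comp_linearForms_sigmaForms]
    exact conic_homogeneous _
  rw [sigmaNet_apply]
  refine IsHomogeneous.sum _ _ _ fun j _ => IsHomogeneous.C_mul ?_ _
  exact (h2 _).mul (h2 _)

theorem eval_col_comp_conics (D E : GL (Fin 3) ℂ) (i j : Fin 3) :
    eval ((E⁻¹).1.col j) (comp (comp (linearForms D) sigmaForms) (linearForms E) i) = 0 := by
  have := eval_comp_conics D E (Pi.single j 1) i
  rw [Matrix.mulVec_single_one] at this
  rw [this, sum_eq_cyclic _ j]
  simp [add_one_add_one, add_two_add_one, add_one_add_two, add_two_add_two]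

theorem eval_col_sigmaNet (A D E : GL (Fin 3) ℂ) (l j : Fin 3) :
    eval ((E⁻¹).1.col j) (sigmaNet A D E l) = 0 := by
  simp [-Matrix.coe_units_inv, sigmaNet_apply, eval_col_comp_conics]

/-- The base points of `σ ∘ E` are double points of the net. -/
theorem eval_col_pderiv_sigmaNet (A D E : GL (Fin 3) ℂ) (l j i : Fin 3) :
    eval ((E⁻¹).1.col j) (pderiv i (sigmaNet A D E l)) = 0 := by
  simp [-Matrix.coe_units_inv, sigmaNet_apply, Derivation.leibniz, eval_col_comp_conics]

/-! ### Excluding length three -/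

/-- The case where the conics `B 0` and `B 1` share no coordinate line, hence are coprime: the
triple of `τ ∘ B ∘ σ` has degree `4`. -/
theorem false_of_no_common_column (A B D E : GL (Fin 3) ℂ)
    (hcol : ¬ ∃ i, B.1 0 i = 0 ∧ B.1 1 i = 0)
    (E₁ : conic (B.1 0) * sigmaNet A D E 1 = conic (B.1 1) * sigmaNet A D E 0)
    (E₂ : conic (B.1 0) * sigmaNet A D E 2 + conic (B.1 2) * sigmaNet A D E 0 =
      conic (B.1 1) * sigmaNet A D E 1) : False := by
  have hdet := det_ne_zero B
  have hL0 := conic_ne_zero (row_ne_zero B 0)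
  obtain ⟨c, hc, -, -⟩ := eq_mul_of_isRelPrime (e := 1) hL0 one_ne_zero
    (isRelPrime_conic (not_exists.1 hcol) (by
      by_contra! hw
      refine hdet ?_
      have w0 := hw 0
      have w1 := hw 1
      have w2 := hw 2
      simp at w0 w1 w2
      rw [Matrix.det_fin_three]
      linear_combination B.1 2 0 * w0 + B.1 2 1 * w1 + B.1 2 2 * w2))
    isRelPrime_one_right isRelPrime_one_left E₁ (by simpa using E₂)
  have hc' := IsHomogeneous.eq_homogeneousComponent_mul (d := 0) (e := 4)
    ((conic_homogeneous _).pow 2) (sigmaNet_homogeneous A D E 0) (by simpa using hc)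
  rw [homogeneousComponent_zero] at hc'
  by_cases h0 : coeff 0 c = 0
  · refine sigmaNet_ne_C_mul_sq A D E 0 0 0 (fun j => by simp [conic]) ?_
    rw [hc', h0]
    simp
  · refine sigmaNet_ne_C_mul_sq A D E _ _ _ (fun j => ?_) hc'
    have := eval_col_sigmaNet A D E 0 j
    rw [hc'] at this
    simpa [h0] using this

/-- The case where the conics `B 0` and `B 1` share the coordinate line `X i`: the triple of
`τ ∘ B ∘ σ` has degree `3`, and the net of quartics has a fixed line `n`. The double points of the
net force `n` to be the line `X i`, so that again the square of the conic `B 0` belongs to the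
net. -/
theorem false_of_common_column (A B D E : GL (Fin 3) ℂ) {i : Fin 3} (h0 : B.1 0 i = 0)
    (h1 : B.1 1 i = 0)
    (E₁ : conic (B.1 0) * sigmaNet A D E 1 = conic (B.1 1) * sigmaNet A D E 0)
    (E₂ : conic (B.1 0) * sigmaNet A D E 2 + conic (B.1 2) * sigmaNet A D E 0 =
      conic (B.1 1) * sigmaNet A D E 1) : False := by
  have hdet := det_ne_zero B
  have hL0 := conic_ne_zero (row_ne_zero B 0)
  have hdet' : B.1.det =
      B.1 2 i * (B.1 0 (i + 1) * B.1 1 (i + 2) - B.1 0 (i + 2) * B.1 1 (i + 1)) := by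
    rw [Matrix.det_fin_three]
    fin_cases i <;> simp at h0 h1 ⊢ <;> simp [h0, h1] <;> ring
  rw [hdet'] at hdet
  have ha : B.1 2 i ≠ 0 := left_ne_zero_of_mul hdet
  have hd := right_ne_zero_of_mul hdet
  set m : Fin 3 → MvPolynomial (Fin 3) ℂ := fun l =>
    C (B.1 l (i + 1)) * X (i + 2) + C (B.1 l (i + 2)) * X (i + 1) with hm
  have hLm0 : conic (B.1 0) = X i * m 0 := by
    rw [conic_eq _ i, h0, hm]; simp only [C_0]; ring
  have hLm1 : conic (B.1 1) = X i * m 1 := by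
    rw [conic_eq _ i, h1, hm]; simp only [C_0]; ring
  have hxi : (X i : MvPolynomial (Fin 3) ℂ) ≠ 0 := X_ne_zero i
  have hm0 : m 0 ≠ 0 := right_ne_zero_of_mul (hLm0 ▸ hL0)
  have hmm (P : Fin 3 → ℂ) (e0 : eval P (m 0) = 0) (e1 : eval P (m 1) = 0) :
      P (i + 1) = 0 ∧ P (i + 2) = 0 := by
    simp only [hm, map_add, map_mul, eval_C, eval_X] at e0 e1
    constructor
    · refine mul_left_cancel₀ hd ?_
      linear_combination B.1 0 (i + 1) * e1 - B.1 1 (i + 1) * e0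
    · refine mul_left_cancel₀ hd ?_
      linear_combination B.1 1 (i + 2) * e0 - B.1 0 (i + 2) * e1
  have hrel : IsRelPrime (m 0) (m 1) := by
    intro g g0 g1
    have hu : IsUnit (C (B.1 0 (i + 1) * B.1 1 (i + 2) - B.1 0 (i + 2) * B.1 1 (i + 1)) :
        MvPolynomial (Fin 3) ℂ) := hd.isUnit.map C
    refine isRelPrime_X_X (K := ℂ) (add_one_ne_add_two i) ?_ ?_
    · refine (hu.dvd_mul_left).1 ?_
      convert (g1.mul_left (C (B.1 0 (i + 1)))).sub (g0.mul_left (C (B.1 1 (i + 1)))) using 1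
      simp only [hm, map_sub, map_mul]
      ring
    · refine (hu.dvd_mul_left).1 ?_
      convert (g0.mul_left (C (B.1 1 (i + 2)))).sub (g1.mul_left (C (B.1 0 (i + 2)))) using 1
      simp only [hm, map_sub, map_mul]
      ring
  have hrel' : IsRelPrime (X i) (m 0) := by
    by_cases h : B.1 0 (i + 1) = 0
    · refine isRelPrime_X_of_eval (P := Pi.single (i + 1) 1)
        (by simp [(add_one_ne i).symm]) ?_
      simp only [hm, map_add, map_mul, eval_C, eval_X, h]
      simp only [h, zero_mul, zero_sub, neg_ne_zero] at hd
      simpa using left_ne_zero_of_mul hd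
    · refine isRelPrime_X_of_eval (P := Pi.single (i + 2) 1)
        (by simp [(add_two_ne i).symm]) ?_
      simpa [hm, add_one_ne_add_two] using h
  obtain ⟨c, c0, -, c2⟩ := eq_mul_of_isRelPrime (p := m 0) (q := m 1) (e := X i)
    (r := conic (B.1 2)) (h₀ := sigmaNet A D E 0) (h₁ := sigmaNet A D E 1)
    (h₂ := sigmaNet A D E 2) hm0 hxi hrel hrel'.symm
    (isRelPrime_X_of_eval (P := fun k => if k = i then 0 else 1) (by simp)
      (by rwa [eval_conic_indicator]))
    (mul_left_cancel₀ hxi (by rw [hLm0, hLm1] at E₁; linear_combination E₁))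
    (by rw [hLm0, hLm1] at E₂; linear_combination E₂)
  have hm1 (l) : (m l).IsHomogeneous 1 :=
    ((isHomogeneous_X _ _).C_mul _).add ((isHomogeneous_X _ _).C_mul _)
  have hx1 := isHomogeneous_X ℂ i
  replace c0 := IsHomogeneous.eq_homogeneousComponent_mul (d := 1) (e := 3)
    (hx1.mul ((hm1 0).pow 2)) (sigmaNet_homogeneous A D E 0) c0
  replace c2 := IsHomogeneous.eq_homogeneousComponent_mul (d := 1) (e := 3)
    ((hx1.mul ((hm1 1).pow 2)).sub ((conic_homogeneous _).mul (hm1 0)))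
    (sigmaNet_homogeneous A D E 2) c2
  obtain ⟨n, hn⟩ := IsHomogeneous.eq_sum_C_mul_X (homogeneousComponent_isHomogeneous 1 c)
  rw [hn] at c0 c2
  clear hn
  by_cases hn0 : n = 0
  · refine sigmaNet_ne_C_mul_sq A D E 0 0 0 (fun j => by simp [conic]) ?_
    rw [c0]
    simp [hn0]
  -- The net has double points at the base points of `σ ∘ E` and the line `n` is reduced, so the
  -- cofactors of `n` vanish there, and so does `n` times each of their derivatives.
  have hR {R : MvPolynomial (Fin 3) ℂ} {l : Fin 3}
      (h : sigmaNet A D E l = (∑ k, C (n k) * X k) * R)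
      (j : Fin 3) : eval ((E⁻¹).1.col j) R = 0 := by
    by_contra hne
    have hv := eval_col_sigmaNet A D E l j
    rw [h, map_mul, mul_eq_zero, or_iff_left hne] at hv
    refine hn0 (funext fun k => ?_)
    have hk := eval_col_pderiv_sigmaNet A D E l j k
    rw [h, Derivation.leibniz, smul_eq_mul, smul_eq_mul, map_add, map_mul, map_mul, hv, zero_mul,
      zero_add, mul_eq_zero, or_iff_right hne] at hk
    simpa [Derivation.leibniz, pderiv_X, Pi.single_apply] using hk
  have hR' {R : MvPolynomial (Fin 3) ℂ} {l : Fin 3}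
      (h : sigmaNet A D E l = (∑ k, C (n k) * X k) * R)
      (j : Fin 3) : (∑ k, n k * (E⁻¹).1 k j) * eval ((E⁻¹).1.col j) (pderiv i R) = 0 := by
    have hk := eval_col_pderiv_sigmaNet A D E l j i
    rw [h, Derivation.leibniz, smul_eq_mul, smul_eq_mul, map_add, map_mul, map_mul, hR h,
      zero_mul, add_zero] at hk
    simpa using hk
  -- At a base point with `X i = 0` the derivatives of the cofactors along `X i` do not all vanish,
  -- so `n` does; any other base point is the `i`-th coordinate point.
  have hnj (j : Fin 3) : ∑ k, n k * (E⁻¹).1 k j = n i * (E⁻¹).1 i j := by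
    have r0 := hR c0 j
    have r2 := hR c2 j
    have d0 := hR' c0 j
    have d2 := hR' c2 j
    have hpm (l) : pderiv i (m l) = 0 := by
      simp [hm, Derivation.leibniz, pderiv_X]
    simp only [map_sub, map_mul, map_pow, Derivation.leibniz, Derivation.leibniz_pow, hpm,
      smul_eq_mul, mul_zero, zero_add, smul_zero, pderiv_X_self, mul_one,
      eval_X, Matrix.col_apply] at r0 r2 d0 d2
    by_cases hx : (E⁻¹).1 i j = 0
    · rw [hx, mul_zero]
      by_contra hne
      have e0 : eval ((E⁻¹).1.col j) (m 0) = 0 := by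
        rw [mul_eq_zero, or_iff_right hne] at d0
        simpa using d0
      have e1 : eval ((E⁻¹).1.col j) (m 1) = 0 := by
        rw [mul_eq_zero, or_iff_right hne] at d2
        simpa [-Matrix.coe_units_inv, e0] using d2
      obtain ⟨h1, h2⟩ := hmm _ e0 e1
      refine col_ne_zero E⁻¹ j (funext fun k => ?_)
      rcases eq_or_eq_add_one_or_eq_add_two i k with rfl | rfl | rfl <;> assumption
    · have e0 : eval ((E⁻¹).1.col j) (m 0) = 0 := by
        rw [mul_eq_zero, or_iff_right hx] at r0
        simpa using r0
      have e1 : eval ((E⁻¹).1.col j) (m 1) = 0 := by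
        rw [e0, mul_zero, sub_zero, mul_eq_zero, or_iff_right hx] at r2
        simpa using r2
      obtain ⟨h1, h2⟩ := hmm _ e0 e1
      rw [Matrix.col_apply] at h1 h2
      rw [sum_eq_cyclic _ i, h1, h2]
      ring
  have hni : n = Pi.single i (n i) := by
    have : Matrix.vecMul n (E⁻¹).1 = Matrix.vecMul (Pi.single i (n i)) (E⁻¹).1 := by
      funext j
      rw [Matrix.single_vecMul]
      exact hnj j
    have := congrArg (fun v => Matrix.vecMul v E.1) this
    simpa only [Matrix.vecMul_vecMul, ← Units.val_mul, inv_mul_cancel, Units.val_one,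
      Matrix.vecMul_one] using this
  refine sigmaNet_ne_C_mul_sq A D E (B.1 0) (n i) 0 (fun j => ?_) ?_
  · have r0 := hR c0 j
    rw [hLm0]
    simpa using r0
  · have : ∑ k, C (n k) * X k = C (n i) * (X i : MvPolynomial (Fin 3) ℂ) := by
      rw [hni, sum_eq_cyclic _ i]
      simp
    rw [c0, this, hLm0]
    ring

/-- `τ ∘ B ∘ σ = A ∘ σ ∘ D ∘ σ ∘ E` is impossible for automorphisms `A`, `B`, `D`, `E`. -/
theorem not_proportional_tau_sigmaNet (A B D E : GL (Fin 3) ℂ) :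
    ¬ Proportional (comp tauForms (comp (linearForms B) sigmaForms))
      (sigmaNet A D E) := by
  intro hprop
  have hL : comp (linearForms B) sigmaForms = fun i => conic (B.1 i) :=
    funext (comp_linearForms_sigmaForms _)
  have hL0 := conic_ne_zero (row_ne_zero B 0)
  have E₁ : conic (B.1 0) * sigmaNet A D E 1 = conic (B.1 1) * sigmaNet A D E 0 := by
    refine mul_left_cancel₀ hL0 ?_
    have := hprop 0 1
    simp only [hL, comp, tauForms, Matrix.cons_val_zero, Matrix.cons_val_one, map_pow, map_mul,
      bind₁_X_right] at this
    linear_combination this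
  have E₂ : conic (B.1 0) * sigmaNet A D E 2 + conic (B.1 2) * sigmaNet A D E 0 =
      conic (B.1 1) * sigmaNet A D E 1 := by
    refine mul_left_cancel₀ hL0 ?_
    have := hprop 0 2
    simp [hL, comp, tauForms] at this
    linear_combination this - conic (B.1 1) * E₁
  by_cases hcol : ∃ i, B.1 0 i = 0 ∧ B.1 1 i = 0
  · obtain ⟨i, h0, h1⟩ := hcol
    exact false_of_common_column A B D E h0 h1 E₁ E₂
  · exact false_of_no_common_column A B D E hcol E₁ E₂

end PlaneCremonaMap

/-- The map `τ = [x² : xy : y² - xz]` has ordinary quadratic length `4`, and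
`τ = [y-x : 2y-x : x-y+z] ∘ σ ∘ [x+z : x : y] ∘ σ ∘ [-y : x-3y+z : x] ∘ σ ∘ [x+z : x : y] ∘ σ ∘
[y-x : -2x+z : 2x-y]` is a minimal decomposition of `τ`. -/
theorem corollary10 :
    PlaneCremonaMap.oq PlaneCremonaMap.tau = 4 ∧
      PlaneCremonaMap.IsMinimalDecomposition PlaneCremonaMap.tau
        [PlaneCremonaMap.tauAlpha₄, PlaneCremonaMap.tauAlpha₃, PlaneCremonaMap.tauAlpha₂,
          PlaneCremonaMap.tauAlpha₁]
        PlaneCremonaMap.tauAlpha₀ := by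
  open PlaneCremonaMap in
  have hmin (L : List PlaneCremonaMap) (α₀ : PlaneCremonaMap) (h : IsDecomposition tau L α₀) :
      4 ≤ L.length := by
    by_contra! hL
    obtain ⟨_, ⟨A, rfl⟩, _, ⟨D, rfl⟩, _, ⟨E, rfl⟩, _, ⟨B, rfl⟩, e⟩ := h.exists_length_three hL
    change tau = linear A * (sigma * (linear D * (sigma * (linear E * (sigma * linear B))))) at e
    have e' : tau * (linear B⁻¹ * sigma) =
        linear A * (sigma * (linear D * sigma * linear E)) := by
      rw [e]
      simp only [mul_assoc]
      rw [← mul_assoc (linear B), ← map_mul, mul_inv_cancel, map_one, one_mul, sigma_mul_sigma,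
        mul_one]
    exact not_proportional_tau_sigmaNet A B⁻¹ D E (mk_eq_mk.1 e')
  refine ⟨le_antisymm ?_ ?_, PlaneCremonaMap.isDecomposition_tau, hmin⟩
  · exact iInf_le_of_le _ (iInf_le_of_le _ (iInf_le _ PlaneCremonaMap.isDecomposition_tau))
  · exact le_iInf fun L => le_iInf fun α₀ => le_iInf fun h => by exact_mod_cast hmin L α₀ h
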